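/- For integers $k\ge 1$, $d\ge 0$ and a real $R\ge 0$, call a probability measure $\Gamma$ on $\mathbb R^d$ a $k$-atomic distribution supported on $B(0,R)$ if $\Gamma=\sum_{j=1}^k w_j\delta_{\mu_j}$ with $w_j\ge 0$, $\sum_{j=1}^k w_j=1$, $\mu_j\in\mathbb R^d$ and $\|\mu_j\|_2\le R$ (atoms may coincide and weights may vanish). Let $P_\Gamma=\Gamma * N(0,I_d)$ be the Gaussian mixture with mixing distribution $\Gamma$, let $M_\ell(\Gamma)=\mathbb E_{U\sim\Gamma}[U^{\otimes \ell}]=\sum_{j=1}^k w_j\mu_j^{\otimes\ell}$ be the order-$\ell$ moment tensor, and let $\|T\|_F=\big(\sum_{j_1,\dots,j_\ell=1}^d T_{j_1,\dots,j_\ell}^2\big)^{1/2}$ be the Frobenius norm of an order-$\ell$ tensor. For probability measures $P,Q$ with densities $p,q$ with respect to a common dominating measure $\mu$, let $H^2(P,Q)=\int(\sqrt p-\sqrt q)^2\,d\mu$ and, if $P\ll Q$, $\mathrm{KL}(P,Q)=\int p\log\frac pq\,d\mu$ and $\chi^2(P,Q)=\int\frac{(p-q)^2}{q}\,d\mu$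 (both are $+\infty$ if $P\not\ll Q$). Theorem (Moment characterization of statistical distances). For every $R\ge 0$ there is a constant $C>0$, depending only on $R$ (and not on $k$ or $d$), such that for all integers $k\ge 1$ and $d\ge 0$, all $k$-atomic distributions $\Gamma,\Gamma'$ supported on the ball $B(0,R)$ in $\mathbb R^d$, and every $D\in\{H^2,\mathrm{KL},\chi^2\}$, $$ (Ck)^{-4k}\max_{\ell\le 2k-1}\|M_\ell(\Gamma)-M_\ell(\Gamma')\|_F^2\;\le\; D(P_\Gamma,P_{\Gamma'})\;\le\; C e^{36k^2}\max_{\ell\le 2k-1}\|M_\ell(\Gamma)-M_\ell(\Gamma')\|_F^2 . $$ -/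

import Mathlib

open MeasureTheory
open scoped ENNReal

noncomputable section

/-- The Euclidean space `ℝ^d`. -/
abbrev Rd (d : ℕ) : Type := EuclideanSpace ℝ (Fin d)

/-- The `k`-atomic distributions `∑ j, w j • δ_(μ j)` on `ℝ^d` supported on the closed ball
`B(0,R)`: `w` is a probability vector of length `k` and `‖μ j‖ ≤ R`. Weights may vanish and
atoms may coincide. -/
def kAtomic (k d : ℕ) (R : ℝ) : Set (Measure (Rd d)) :=
  {Γ | ∃ w : Fin k → ℝ, ∃ μ : Fin k → Rd d,
    (∀ j, 0 ≤ w j) ∧ ∑ j, w j = 1 ∧ (∀ j, ‖μ j‖ ≤ R) ∧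
      Γ = ∑ j, ENNReal.ofReal (w j) • Measure.dirac (μ j)}

/-- The Gaussian mixture `P_Γ = Γ * N(0, I_d)` with mixing distribution `Γ`. -/
def gaussianMixture {d : ℕ} (Γ : Measure (Rd d)) : Measure (Rd d) :=
  Measure.conv Γ (ProbabilityTheory.stdGaussian (Rd d))

/-- The order-`ℓ` moment tensor `M_ℓ(Γ) = E[U ⊗ ⋯ ⊗ U]`, `U ∼ Γ`, given by its entries
`E[U_(j 1) ⋯ U_(j ℓ)]`. -/
def momentTensor {d : ℕ} (ℓ : ℕ) (Γ : Measure (Rd d)) : (Fin ℓ → Fin d) → ℝ :=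
  fun j => ∫ u, ∏ i, u (j i) ∂Γ

/-- The Frobenius norm of an order-`ℓ` tensor. -/
def frobeniusNorm {d ℓ : ℕ} (T : (Fin ℓ → Fin d) → ℝ) : ℝ :=
  Real.sqrt (∑ j, T j ^ 2)

/-- `max_{ℓ ≤ 2k-1} ‖M_ℓ(Γ) - M_ℓ(Γ')‖_F²`. The order `ℓ = 0` contributes `0` when both are
probability measures. -/
def maxMomentDiffSq {d : ℕ} (k : ℕ) (Γ Γ' : Measure (Rd d)) : ℝ :=
  (Finset.Iic (2 * k - 1)).sup' Finset.nonempty_Iic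
    fun ℓ => frobeniusNorm (momentTensor ℓ Γ - momentTensor ℓ Γ') ^ 2

/-- The squared Hellinger distance `∫ (√p - √q)² dμ`, where `p`, `q` are the densities of `P`, `Q`
with respect to the dominating measure `μ = P + Q`. -/
def hellingerSq {α : Type*} [MeasurableSpace α] (P Q : Measure α) : ℝ≥0∞ :=
  ∫⁻ x, ENNReal.ofReal ((Real.sqrt (P.rnDeriv (P + Q) x).toReal
    - Real.sqrt (Q.rnDeriv (P + Q) x).toReal) ^ 2) ∂(P + Q)

open Classical in
/-- The `χ²`-divergence `∫ (p - q)² / q dμ` of `P` from `Q`, taken with `μ = Q`, so that `q = 1` and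
`p = dP/dQ`; it is `∞` unless `P ≪ Q`. -/
def chiSqDiv {α : Type*} [MeasurableSpace α] (P Q : Measure α) : ℝ≥0∞ :=
  if P ≪ Q then ∫⁻ x, ENNReal.ofReal (((P.rnDeriv Q x).toReal - 1) ^ 2) ∂Q else ∞

end

/-! With respect to `N(0, I)`, the difference of the two mixture densities is `f = ∑ i, a i *
gaussianTilt (x i)`: a signed sum over the `2k` atoms of both mixing distributions, with `a = (w,
-w')`. Gaussian integration turns `∫ gaussianTilt c * f ^ 2` into `exp (-‖c‖ ^ 2) * ∑ i j, a i * a j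
* exp ⟪x i + c, x j + c⟫`. Expanding the exponential makes the double sum `∑ l, ‖∑ i, a i (x i +
c)^⊗l‖² / l!`, a weighted sum of squared moment differences of all orders.

Newton interpolation at the `2k` atoms controls every order by the orders below `2k`: if those
differences are at most `δ`, the order-`l` tensor is at most `(4r)^l δ` for any shift `c` with `‖c‖
≤ r`. Hence the series is at most `exp (16 r²) δ²`, uniformly in `k` and `d`.

Upper bound: by Jensen, the reciprocal of a mixture density is at most `exp (r²)` times a single
tilt, so `χ²` is bounded by such an integral. Lower bound: `f` itself is a test function for the
Hellinger distance. Its means under the two mixtures differ by `∫ f²`, which is at least `δ² / l!`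
at the maximizing order `l`, and its second moments are at most `exp (16 r²) δ²`. The chain `H² ≤ KL
≤ χ²` transfers both bounds to all three divergences. -/

open scoped RealInnerProductSpace

/-! ### Norms of signed sums of elementary tensors -/

/-- The squared Frobenius norm of `∑ i, a i • (u₁ i ⊗ u₂ i ⊗ ⋯)`, where `W = [u₁, u₂, …]`. -/
noncomputable def tensorSq {ι : Type*} [Fintype ι] {d : ℕ} (a : ι → ℝ) (W : List (ι → Rd d)) : ℝ :=
  ∑ i, ∑ j, a i * a j * (W.map fun u => ⟪u i, u j⟫).prod

lemma rd_inner_eq_sum {d : ℕ} (x y : Rd d) : ⟪x, y⟫ = ∑ e, x e * y e := by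
  simp [PiLp.inner_apply, mul_comm]

/-- The kernel of a word of vector fields is the Gram matrix of its entries. -/
lemma exists_feature {ι : Type*} {d : ℕ} (W : List (ι → Rd d)) :
    ∃ (H : Type) (_ : Fintype H) (F : ι → H → ℝ),
      ∀ i j, (W.map fun u => ⟪u i, u j⟫).prod = ∑ h, F i h * F j h := by
  induction W with
  | nil => exact ⟨Unit, inferInstance, fun _ _ => 1, by simp⟩
  | cons u W ih =>
    obtain ⟨H, _, F, hF⟩ := ih
    refine ⟨Fin d × H, inferInstance, fun i p => u i p.1 * F i p.2, fun i j => ?_⟩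
    rw [List.map_cons, List.prod_cons, hF, rd_inner_eq_sum, Finset.sum_mul_sum,
      Fintype.sum_prod_type]
    exact Finset.sum_congr rfl fun _ _ => Finset.sum_congr rfl fun _ _ => by ring

section Tensor

variable {ι : Type*} [Fintype ι] {d : ℕ} (a : ι → ℝ)

lemma tensorSq_perm {W W' : List (ι → Rd d)} (h : W.Perm W') : tensorSq a W = tensorSq a W' := by
  unfold tensorSq
  refine Finset.sum_congr rfl fun i _ => Finset.sum_congr rfl fun j _ => ?_
  rw [(h.map fun u => ⟪u i, u j⟫).prod_eq]

lemma sum_sum_mul_gram {H : Type*} [Fintype H] (F : ι → H → ℝ) :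
    ∑ i, ∑ j, a i * a j * ∑ h, F i h * F j h = ∑ h, (∑ i, a i * F i h) ^ 2 := by
  simp_rw [pow_two, Finset.sum_mul_sum, Finset.mul_sum]
  rw [Finset.sum_comm' (t' := Finset.univ) (s' := fun _ => Finset.univ) (by simp)]
  rw [Finset.sum_comm]
  simp_rw [fun i => Finset.sum_comm (s := (Finset.univ : Finset ι)) (t := (Finset.univ : Finset H))
    (f := fun j h => a i * a j * (F i h * F j h))]
  rw [Finset.sum_comm]
  exact Finset.sum_congr rfl fun _ _ => Finset.sum_congr rfl fun _ _ =>
    Finset.sum_congr rfl fun _ _ => by ring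

lemma tensorSq_nonneg (W : List (ι → Rd d)) : 0 ≤ tensorSq a W := by
  obtain ⟨H, _, F, hF⟩ := exists_feature W
  simp_rw [tensorSq, hF, sum_sum_mul_gram]
  positivity

/-- The Frobenius norm of `∑ i, a i • (u₁ i ⊗ u₂ i ⊗ ⋯)`, where `W = [u₁, u₂, …]`. -/
noncomputable def tensorNorm (W : List (ι → Rd d)) : ℝ := Real.sqrt (tensorSq a W)

lemma tensorNorm_nonneg (W : List (ι → Rd d)) : 0 ≤ tensorNorm a W := Real.sqrt_nonneg _

lemma tensorNorm_sq (W : List (ι → Rd d)) : tensorNorm a W ^ 2 = tensorSq a W :=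
  Real.sq_sqrt (tensorSq_nonneg a W)

lemma tensorNorm_perm {W W' : List (ι → Rd d)} (h : W.Perm W') :
    tensorNorm a W = tensorNorm a W' := by
  rw [tensorNorm, tensorSq_perm a h, tensorNorm]

/-- With the other slots fixed, the tensor is linear in its first slot; `T` lists its entries, and
the claim is the Euclidean triangle inequality. -/
lemma tensorNorm_cons_add_le (u v : ι → Rd d) (W : List (ι → Rd d)) :
    tensorNorm a ((u + v) :: W) ≤ tensorNorm a (u :: W) + tensorNorm a (v :: W) := by
  obtain ⟨H, _, F, hF⟩ := exists_feature W
  let T : (ι → Rd d) → EuclideanSpace ℝ (Fin d × H) := fun u =>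
    WithLp.toLp 2 fun p => ∑ i, a i * (u i p.1 * F i p.2)
  have hT (u : ι → Rd d) : tensorNorm a (u :: W) = ‖T u‖ := by
    rw [EuclideanSpace.norm_eq, tensorNorm, tensorSq]
    congr 1
    simp only [T, Real.norm_eq_abs, sq_abs]
    rw [← sum_sum_mul_gram]
    refine Finset.sum_congr rfl fun i _ => Finset.sum_congr rfl fun j _ => ?_
    rw [List.map_cons, List.prod_cons, hF, rd_inner_eq_sum, Finset.sum_mul_sum,
      Fintype.sum_prod_type]
    congr 1
    exact Finset.sum_congr rfl fun _ _ => Finset.sum_congr rfl fun _ _ => by ring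
  have hadd : T (u + v) = T u + T v := by
    ext p
    simp [T, add_mul, mul_add, Finset.sum_add_distrib]
  rw [hT, hT, hT, hadd]
  exact norm_add_le _ _

lemma tensorNorm_cons_const (c : Rd d) (W : List (ι → Rd d)) :
    tensorNorm a ((fun _ => c) :: W) = ‖c‖ * tensorNorm a W := by
  have h : tensorSq a ((fun _ => c) :: W) = ‖c‖ ^ 2 * tensorSq a W := by
    simp_rw [tensorSq, Finset.mul_sum, List.map_cons, List.prod_cons, real_inner_self_eq_norm_sq]
    exact Finset.sum_congr rfl fun _ _ => Finset.sum_congr rfl fun _ _ => by ring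
  rw [tensorNorm, h, Real.sqrt_mul (by positivity), Real.sqrt_sq (norm_nonneg _), tensorNorm]

lemma tensorNorm_cons_sub_le (x : ι → Rd d) (s : Rd d) (W : List (ι → Rd d)) :
    tensorNorm a ((fun i => x i - s) :: W) ≤ tensorNorm a (x :: W) + ‖s‖ * tensorNorm a W := by
  have h := tensorNorm_cons_add_le a x (fun _ => -s) W
  rw [tensorNorm_cons_const, norm_neg] at h
  convert h using 3
  ext i
  simp [sub_eq_add_neg]

/-- A tensor with a Newton factor `x i - s` at every node `s ∈ S` vanishes if all `x i` are nodes. -/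
lemma tensorNorm_eq_zero_of_mem_nodes (x : ι → Rd d) (S : List (Rd d)) (hS : ∀ i, x i ∈ S)
    (W : List (ι → Rd d)) : tensorNorm a (W ++ S.map fun s i => x i - s) = 0 := by
  rw [tensorNorm, tensorSq, Real.sqrt_eq_zero']
  refine le_of_eq (Finset.sum_eq_zero fun i _ => Finset.sum_eq_zero fun j _ => ?_)
  rw [List.prod_eq_zero, mul_zero]
  simp only [List.map_append, List.map_map, List.mem_append, List.mem_map, Function.comp_apply]
  exact Or.inr ⟨x i, hS i, by simp⟩

/-! ### Newton interpolation and the exponential kernel -/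

variable {x : ι → Rd d} {n : ℕ} {r δ : ℝ}

/-- Expanding one factor `x - s` leaves one more power of `x`, or a factor `‖s‖ ≤ r`; since `1 + r ≤
2 * r`, each node costs `2 * r`. The total order stays below `n`. -/
lemma tensorNorm_replicate_append_nodes_le (hr : 1 ≤ r)
    (hδ : ∀ l < n, tensorNorm a (List.replicate l x) ≤ δ) (S : List (Rd d))
    (hS : ∀ s ∈ S, ‖s‖ ≤ r) (l : ℕ) (hl : l + S.length < n) :
    tensorNorm a (List.replicate l x ++ S.map fun s i => x i - s) ≤ (2 * r) ^ S.length * δ := by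
  induction S generalizing l with
  | nil => simpa using hδ l (by simpa using hl)
  | cons s S ih =>
    rw [List.length_cons] at hl
    have hS' : ∀ s ∈ S, ‖s‖ ≤ r := fun s hs => hS s (List.mem_cons_of_mem _ hs)
    have h1 := ih hS' (l + 1) (by omega)
    have h0 := ih hS' l (by omega)
    have hs : ‖s‖ ≤ r := hS s (by simp)
    rw [List.map_cons, tensorNorm_perm a List.perm_middle]
    refine (tensorNorm_cons_sub_le a x s _).trans ?_
    rw [List.replicate_succ, List.cons_append] at h1
    have h0' := tensorNorm_nonneg a (List.replicate l x ++ S.map fun s i => x i - s)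
    have h2 := mul_le_mul hs h0 h0' (by linarith)
    rw [List.length_cons, pow_succ]
    have h3 : 0 ≤ (2 * r) ^ S.length * δ := h0'.trans h0
    nlinarith

/-- Newton interpolation for signed sums of tensor powers: the tensors of order `< n` control all
the others if there are at most `n` points. -/
lemma tensorNorm_replicate_add_append_nodes_le (hr : 1 ≤ r)
    (hδ : ∀ l < n, tensorNorm a (List.replicate l x) ≤ δ) {m : Rd d} (hm : ‖m‖ ≤ r) (l : ℕ)
    (S T : List (Rd d)) (hST : S.length + T.length ≤ n) (hx : ∀ i, x i ∈ S ∨ x i ∈ T)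
    (hS : ∀ s ∈ S, ‖s‖ ≤ r) (hT : ∀ s ∈ T, ‖s‖ ≤ r) (hδ0 : 0 ≤ δ) :
    tensorNorm a (List.replicate l (fun i => x i + m) ++ S.map fun s i => x i - s)
      ≤ 2 ^ l * (2 * r) ^ (l + S.length) * δ := by
  induction l generalizing S T with
  | zero =>
    cases T with
    -- Every point is already a node, so the Newton product vanishes at each of them.
    | nil =>
      rw [tensorNorm_eq_zero_of_mem_nodes a x S (fun i => by simpa using hx i)]
      positivity
    | cons t T =>
      have := tensorNorm_replicate_append_nodes_le a hr hδ S hS 0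
        (by simp only [List.length_cons] at hST; omega)
      simpa using this
  | succ l ih =>
    cases T with
    | nil =>
      rw [tensorNorm_eq_zero_of_mem_nodes a x S (fun i => by simpa using hx i)]
      positivity
    | cons t T =>
      have ht : ‖t‖ ≤ r := hT t (by simp)
      have h1 := ih (t :: S) T (by simp only [List.length_cons] at hST ⊢; omega)
        (fun i => by have := hx i; simp only [List.mem_cons] at this ⊢; tauto)
        (by simp only [List.mem_cons, forall_eq_or_imp]; exact ⟨ht, hS⟩)
        (fun s hs => hT s (List.mem_cons_of_mem _ hs))
      have h0 := ih S (t :: T) hST hx hS hT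
      -- The factor `x + m` is traded for a new Newton factor at the unused node `t`, plus a
      -- constant of norm at most `2 * r`. Two such terms at each of `l` steps give `2 ^ l`.
      have hsplit : (fun i => x i + m) = (fun i => x i - t) + fun _ => t + m := by
        ext1 i
        simp only [Pi.add_apply]
        abel
      set W := List.replicate l (fun i => x i + m) ++ S.map fun s i => x i - s with hW
      have h2 : tensorNorm a ((fun i => x i + m) :: W) ≤
          tensorNorm a ((fun i => x i - t) :: W) + ‖t + m‖ * tensorNorm a W := by
        have h := tensorNorm_cons_add_le a (fun i => x i - t) (fun _ => t + m) W
        rwa [tensorNorm_cons_const, ← hsplit] at h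
      have htm : ‖t + m‖ ≤ 2 * r := (norm_add_le _ _).trans (by linarith)
      have h3 := mul_le_mul htm h0 (tensorNorm_nonneg a W) (by linarith)
      rw [List.map_cons, tensorNorm_perm a List.perm_middle] at h1
      rw [List.replicate_succ, List.cons_append]
      refine h2.trans ((add_le_add h1 h3).trans (le_of_eq ?_))
      rw [List.length_cons]
      ring

/-- `⟪y i, y j⟫ ^ l` is the inner product of the `l`-th tensor powers, so this is the power series
of `exp`, entry by entry. -/
lemma hasSum_tensorSq_replicate (y : ι → Rd d) :
    HasSum (fun l : ℕ => tensorSq a (List.replicate l y) / (l.factorial : ℝ))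
      (∑ i, ∑ j, a i * a j * Real.exp ⟪y i, y j⟫) := by
  simp_rw [tensorSq, Finset.sum_div]
  refine hasSum_sum fun i _ => hasSum_sum fun j _ => ?_
  have h := (NormedSpace.expSeries_div_hasSum_exp (⟪y i, y j⟫)).mul_left (a i * a j)
  rw [← Real.exp_eq_exp_ℝ] at h
  simpa [List.map_replicate, List.prod_replicate, mul_div_assoc] using h

lemma sum_exp_inner_add_le (hr : 1 ≤ r)
    (hδ : ∀ l < n, tensorNorm a (List.replicate l x) ≤ δ) {m : Rd d} (hm : ‖m‖ ≤ r)
    (hn : Fintype.card ι ≤ n) (hx : ∀ i, ‖x i‖ ≤ r) (hδ0 : 0 ≤ δ) :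
    ∑ i, ∑ j, a i * a j * Real.exp ⟪x i + m, x j + m⟫ ≤ Real.exp (16 * r ^ 2) * δ ^ 2 := by
  have h1 := hasSum_tensorSq_replicate a (fun i => x i + m)
  have h2 := (NormedSpace.expSeries_div_hasSum_exp (16 * r ^ 2 : ℝ)).mul_right (δ ^ 2)
  rw [← Real.exp_eq_exp_ℝ] at h2
  refine hasSum_le (fun l => ?_) h1 h2
  have hb := tensorNorm_replicate_add_append_nodes_le a hr hδ hm l []
    (Finset.univ.toList.map x) (by simpa using hn) (fun i => by simp) (by simp)
    (by simpa using hx) hδ0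
  simp only [List.map_nil, List.append_nil, List.length_nil, add_zero] at hb
  rw [div_mul_eq_mul_div]
  gcongr
  rw [← tensorNorm_sq]
  refine (pow_le_pow_left₀ (tensorNorm_nonneg _ _) hb 2).trans (le_of_eq ?_)
  rw [show (16 * r ^ 2 : ℝ) = (2 * (2 * r)) ^ 2 by ring, ← mul_pow, mul_pow, ← pow_mul, ← pow_mul,
    mul_comm l 2]

lemma tensorSq_replicate_div_factorial_le (x : ι → Rd d) (l : ℕ) :
    tensorSq a (List.replicate l x) / (l.factorial : ℝ)
      ≤ ∑ i, ∑ j, a i * a j * Real.exp ⟪x i, x j⟫ :=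
  le_hasSum (hasSum_tensorSq_replicate a x) l fun _ _ =>
    div_nonneg (tensorSq_nonneg _ _) (by positivity)

end Tensor

/-! ### Comparison of statistical distances -/

section Divergence

variable {α : Type*} [MeasurableSpace α]

/-- The integrand is homogeneous of degree one in the two densities, so the dominating measure `P +
Q` may be replaced by `Q`. -/
lemma hellingerSq_eq_lintegral_rnDeriv (P Q : Measure α) [IsFiniteMeasure P] [IsFiniteMeasure Q]
    (h : P ≪ Q) : hellingerSq P Q =
      ∫⁻ x, ENNReal.ofReal ((Real.sqrt (P.rnDeriv Q x).toReal - 1) ^ 2) ∂Q := by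
  have hPQ : P + Q ≪ Q := h.add_left .rfl
  rw [hellingerSq, ← lintegral_rnDeriv_mul hPQ (by fun_prop)]
  refine lintegral_congr_ae ?_
  filter_upwards [Measure.rnDeriv_mul_rnDeriv (κ := Q) (Measure.le_add_right (le_refl P) :
      P ≤ P + Q).absolutelyContinuous, Measure.rnDeriv_mul_rnDeriv (κ := Q)
      (Measure.le_add_left (le_refl Q) : Q ≤ P + Q).absolutelyContinuous, Q.rnDeriv_self,
      (P + Q).rnDeriv_lt_top Q] with x h1 h2 h3 h4
  rw [h3] at h2
  simp only [Pi.mul_apply] at h1 h2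
  rw [← h1, ← ENNReal.ofReal_toReal h4.ne, ← ENNReal.ofReal_mul ENNReal.toReal_nonneg]
  have h2' := congrArg ENNReal.toReal h2
  rw [ENNReal.toReal_mul, ENNReal.toReal_one] at h2'
  simp only [ENNReal.toReal_mul]
  set p := (P.rnDeriv (P + Q) x).toReal
  set q := (Q.rnDeriv (P + Q) x).toReal
  set s := ((P + Q).rnDeriv Q x).toReal
  have hs : 0 ≤ s := ENNReal.toReal_nonneg
  have hp : 0 ≤ p := ENNReal.toReal_nonneg
  have hq : 0 ≤ q := ENNReal.toReal_nonneg
  have hq' : Real.sqrt q * Real.sqrt s = 1 := by rw [← Real.sqrt_mul hq, h2', Real.sqrt_one]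
  rw [ENNReal.toReal_ofReal hs, Real.sqrt_mul hp, ← hq', ← sub_mul, mul_pow, Real.sq_sqrt hs,
    mul_comm]

/-- Put `s = √r`: the bound `log s ≥ 1 - 1 / s` gives `r log r ≥ 2 s² - 2 s`. -/
lemma sqrt_sub_one_sq_le_klFun {r : ℝ} (hr : 0 ≤ r) :
    (Real.sqrt r - 1) ^ 2 ≤ InformationTheory.klFun r := by
  rcases hr.eq_or_lt with rfl | hr
  · simp [InformationTheory.klFun]
  have hs := Real.sqrt_pos.2 hr
  have h1 := Real.one_sub_inv_le_log_of_pos hs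
  have h2 : Real.log r = 2 * Real.log (Real.sqrt r) := by rw [Real.log_sqrt hr.le]; ring
  have h3 : r = Real.sqrt r ^ 2 := (Real.sq_sqrt hr.le).symm
  rw [InformationTheory.klFun_apply, h2]
  set s := Real.sqrt r
  have h4 : s ^ 2 * (1 - s⁻¹) = s ^ 2 - s := by field_simp
  have h5 := mul_le_mul_of_nonneg_left h1 (sq_nonneg s)
  rw [h3]
  nlinarith

lemma klFun_le_sub_one_sq {r : ℝ} (hr : 0 ≤ r) : InformationTheory.klFun r ≤ (r - 1) ^ 2 := by
  rw [InformationTheory.klFun_apply]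
  rcases hr.eq_or_lt with rfl | hr
  · simp
  nlinarith [mul_le_mul_of_nonneg_left (Real.log_le_sub_one_of_pos hr) hr.le]

lemma hellingerSq_le_klDiv (P Q : Measure α) [IsFiniteMeasure P] [IsFiniteMeasure Q] :
    hellingerSq P Q ≤ InformationTheory.klDiv P Q := by
  by_cases h : P ≪ Q
  · rw [hellingerSq_eq_lintegral_rnDeriv P Q h, InformationTheory.klDiv_eq_lintegral_klFun_of_ac h]
    exact lintegral_mono fun x =>
      ENNReal.ofReal_le_ofReal (sqrt_sub_one_sq_le_klFun ENNReal.toReal_nonneg)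
  · simp [InformationTheory.klDiv_of_not_ac h]

lemma klDiv_le_chiSqDiv (P Q : Measure α) [IsFiniteMeasure P] [IsFiniteMeasure Q] :
    InformationTheory.klDiv P Q ≤ chiSqDiv P Q := by
  rw [chiSqDiv]
  split_ifs with h
  · rw [InformationTheory.klDiv_eq_lintegral_klFun_of_ac h]
    exact lintegral_mono fun x =>
      ENNReal.ofReal_le_ofReal (klFun_le_sub_one_sq ENNReal.toReal_nonneg)
  · exact le_top

/-- Variational lower bound on the squared Hellinger distance. -/
lemma exists_hellingerSq_eq_ofReal (P Q : Measure α) [IsFiniteMeasure P] [IsFiniteMeasure Q] :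
    ∃ H : ℝ, hellingerSq P Q = ENNReal.ofReal H ∧
      ∀ (f : α → ℝ) (t : ℝ), 0 < t → Integrable f P → Integrable f Q →
        Integrable (fun x => f x ^ 2) P → Integrable (fun x => f x ^ 2) Q →
        ∫ x, f x ∂P - ∫ x, f x ∂Q
          ≤ t / 2 * H + t⁻¹ * (∫ x, f x ^ 2 ∂P + ∫ x, f x ^ 2 ∂Q) := by
  set M := P + Q with hM
  have hP : P ≪ M := (Measure.le_add_right (le_refl P) : P ≤ P + Q).absolutelyContinuous
  have hQ : Q ≪ M := (Measure.le_add_left (le_refl Q) : Q ≤ P + Q).absolutelyContinuous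
  set p : α → ℝ := fun x => (P.rnDeriv M x).toReal
  set q : α → ℝ := fun x => (Q.rnDeriv M x).toReal
  have hp0 (x) : 0 ≤ p x := ENNReal.toReal_nonneg
  have hq0 (x) : 0 ≤ q x := ENNReal.toReal_nonneg
  have hpi : Integrable p M := Measure.integrable_toReal_rnDeriv
  have hqi : Integrable q M := Measure.integrable_toReal_rnDeriv
  have hint : Integrable (fun x => (Real.sqrt (p x) - Real.sqrt (q x)) ^ 2) M := by
    refine (hpi.add hqi).mono' (Measurable.aestronglyMeasurable (by fun_prop))
      (ae_of_all _ fun x => ?_)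
    have h1 := Real.sq_sqrt (hp0 x)
    have h2 := Real.sq_sqrt (hq0 x)
    have := mul_nonneg (Real.sqrt_nonneg (p x)) (Real.sqrt_nonneg (q x))
    rw [Real.norm_of_nonneg (sq_nonneg _), Pi.add_apply]
    nlinarith
  refine ⟨∫ x, (Real.sqrt (p x) - Real.sqrt (q x)) ^ 2 ∂M, ?_, ?_⟩
  · rw [ofReal_integral_eq_lintegral_ofReal hint (ae_of_all _ fun x => sq_nonneg _)]
    rfl
  intro f t ht hfP hfQ hfP2 hfQ2
  have hfP' : Integrable (fun x => p x * f x) M :=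
    (integrable_rnDeriv_smul_iff (E := ℝ) hP).2 hfP
  have hfQ' : Integrable (fun x => q x * f x) M :=
    (integrable_rnDeriv_smul_iff (E := ℝ) hQ).2 hfQ
  have hfP2' : Integrable (fun x => p x * f x ^ 2) M :=
    (integrable_rnDeriv_smul_iff (E := ℝ) hP).2 hfP2
  have hfQ2' : Integrable (fun x => q x * f x ^ 2) M :=
    (integrable_rnDeriv_smul_iff (E := ℝ) hQ).2 hfQ2
  have e1 : ∫ x, p x * f x ∂M = ∫ x, f x ∂P := integral_rnDeriv_smul (E := ℝ) hP
  have e2 : ∫ x, q x * f x ∂M = ∫ x, f x ∂Q := integral_rnDeriv_smul (E := ℝ) hQ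
  have e3 : ∫ x, p x * f x ^ 2 ∂M = ∫ x, f x ^ 2 ∂P := integral_rnDeriv_smul (E := ℝ) hP
  have e4 : ∫ x, q x * f x ^ 2 ∂M = ∫ x, f x ^ 2 ∂Q := integral_rnDeriv_smul (E := ℝ) hQ
  have hsum : Integrable (fun x => t⁻¹ * (p x * f x ^ 2 + q x * f x ^ 2)) M :=
    (hfP2'.add hfQ2').const_mul _
  rw [← e1, ← e2, ← e3, ← e4, ← integral_sub hfP' hfQ', ← integral_add hfP2' hfQ2',
    ← integral_const_mul, ← integral_const_mul,
    ← integral_add (hint.const_mul _) hsum]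
  refine integral_mono (hfP'.sub hfQ') ((hint.const_mul _).add hsum) fun x => ?_
  have h1 := Real.sq_sqrt (hp0 x)
  have h2 := Real.sq_sqrt (hq0 x)
  dsimp only
  rw [← h1, ← h2]
  simp only [Real.sqrt_sq (Real.sqrt_nonneg _)]
  set u := Real.sqrt (p x)
  set v := Real.sqrt (q x)
  -- This is AM-GM for `(u - v) * (u + v) * f`; the extra square uses `(u + v)² + (u - v)² = 2 (u² +
  -- v²)` to give exactly the second moments.
  have key : 0 ≤ t⁻¹ * ((t * (u - v) - (u + v) * f x) ^ 2 / 2 + (u - v) ^ 2 * f x ^ 2 / 2) := by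
    positivity
  have expand : t⁻¹ * ((t * (u - v) - (u + v) * f x) ^ 2 / 2 + (u - v) ^ 2 * f x ^ 2 / 2)
      = t / 2 * (u - v) ^ 2 + t⁻¹ * (u ^ 2 * f x ^ 2 + v ^ 2 * f x ^ 2)
        - (u ^ 2 * f x - v ^ 2 * f x) := by
    field_simp
    ring
  linarith

end Divergence

/-! ### Gaussian mixtures -/

section Gaussian

open ProbabilityTheory

variable {d : ℕ}

lemma integrable_exp_inner_stdGaussian (u : Rd d) :
    Integrable (fun x => Real.exp ⟪u, x⟫) (stdGaussian (Rd d)) := by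
  rw [← map_pi_eq_stdGaussian, integrable_map_measure (by fun_prop) (by fun_prop)]
  have h : ((fun x : Rd d => Real.exp ⟪u, x⟫) ∘ WithLp.toLp 2)
      = fun x : Fin d → ℝ => ∏ i, Real.exp (u i * x i) := by
    ext x
    simp [rd_inner_eq_sum, Real.exp_sum]
  rw [h]
  exact Integrable.fintype_prod (f := fun i x => Real.exp (u i * x))
    fun i => integrable_exp_mul_gaussianReal (u i)

/-- At `t = 0` this normalizes the tilts; general `t` gives the characteristic function of a tilted
Gaussian. -/
lemma integral_cexp_stdGaussian (u t : Rd d) :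
    ∫ x, Complex.exp (⟪u, x⟫ + ⟪x, t⟫ * Complex.I) ∂(stdGaussian (Rd d))
      = Complex.exp ((‖u‖ ^ 2 : ℝ) / 2 + ⟪u, t⟫ * Complex.I - (‖t‖ ^ 2 : ℝ) / 2) := by
  rw [← map_pi_eq_stdGaussian, integral_map (by fun_prop) (by fun_prop)]
  have h (x : Fin d → ℝ) :
      Complex.exp (⟪u, WithLp.toLp 2 x⟫ + ⟪WithLp.toLp 2 x, t⟫ * Complex.I)
        = ∏ i, Complex.exp ((u i + t i * Complex.I) * x i) := by
    rw [← Complex.exp_sum, rd_inner_eq_sum, rd_inner_eq_sum]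
    congr 1
    push_cast
    rw [Finset.sum_mul, ← Finset.sum_add_distrib]
    exact Finset.sum_congr rfl fun _ _ => by ring
  simp_rw [h]
  rw [integral_fintype_prod_eq_prod (f := fun i (x : ℝ) => Complex.exp ((u i + t i * Complex.I) * x))]
  have h1 (z : ℂ) : ∫ x : ℝ, Complex.exp (z * x) ∂(gaussianReal 0 1) = Complex.exp (z ^ 2 / 2) := by
    have := complexMGF_id_gaussianReal (μ := 0) (v := 1) z
    simpa [complexMGF] using this
  simp_rw [h1]
  rw [← Complex.exp_sum, EuclideanSpace.real_norm_sq_eq, EuclideanSpace.real_norm_sq_eq,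
    rd_inner_eq_sum]
  congr 1
  push_cast
  rw [Finset.sum_mul, Finset.sum_div, Finset.sum_div, ← Finset.sum_add_distrib,
    ← Finset.sum_sub_distrib]
  refine Finset.sum_congr rfl fun i _ => ?_
  linear_combination (t i : ℂ) ^ 2 / 2 * Complex.I_sq

lemma integral_exp_inner_stdGaussian (u : Rd d) :
    ∫ x, Real.exp ⟪u, x⟫ ∂(stdGaussian (Rd d)) = Real.exp (‖u‖ ^ 2 / 2) := by
  have h := integral_cexp_stdGaussian u 0
  simp only [inner_zero_right, Complex.ofReal_zero, zero_mul, add_zero, norm_zero] at h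
  have h' : ∫ x, ((Real.exp ⟪u, x⟫ : ℝ) : ℂ) ∂(stdGaussian (Rd d))
      = ((Real.exp (‖u‖ ^ 2 / 2) : ℝ) : ℂ) := by
    push_cast
    simpa using h
  rw [integral_complex_ofReal] at h'
  exact_mod_cast h'

/-- The density of `N(u, I)` with respect to `N(0, I)`. -/
noncomputable def gaussianTilt (u x : Rd d) : ℝ := Real.exp (⟪u, x⟫ - ‖u‖ ^ 2 / 2)

@[fun_prop]
lemma measurable_gaussianTilt (u : Rd d) : Measurable (gaussianTilt u) := by
  unfold gaussianTilt
  fun_prop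

lemma gaussianTilt_pos (u x : Rd d) : 0 < gaussianTilt u x := Real.exp_pos _

lemma gaussianTilt_eq (u x : Rd d) :
    gaussianTilt u x = Real.exp (-(‖u‖ ^ 2 / 2)) * Real.exp ⟪u, x⟫ := by
  rw [gaussianTilt, ← Real.exp_add]
  ring_nf

lemma integrable_gaussianTilt (u : Rd d) : Integrable (gaussianTilt u) (stdGaussian (Rd d)) := by
  have h := (integrable_exp_inner_stdGaussian u).const_mul (Real.exp (-(‖u‖ ^ 2 / 2)))
  exact h.congr (ae_of_all _ fun x => (gaussianTilt_eq u x).symm)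

lemma integral_gaussianTilt (u : Rd d) : ∫ x, gaussianTilt u x ∂(stdGaussian (Rd d)) = 1 := by
  simp_rw [gaussianTilt_eq]
  rw [integral_const_mul, integral_exp_inner_stdGaussian, ← Real.exp_add]
  simp

lemma gaussianTilt_mul_gaussianTilt (u v x : Rd d) :
    gaussianTilt u x * gaussianTilt v x = Real.exp ⟪u, v⟫ * gaussianTilt (u + v) x := by
  simp_rw [gaussianTilt, ← Real.exp_add, norm_add_sq_real, inner_add_left]
  ring_nf

/-- **Cameron–Martin formula** for the standard Gaussian measure. -/
lemma map_const_add_stdGaussian (u : Rd d) :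
    (stdGaussian (Rd d)).map (fun x => u + x)
      = (stdGaussian (Rd d)).withDensity fun x => ENNReal.ofReal (gaussianTilt u x) := by
  have : IsFiniteMeasure
      ((stdGaussian (Rd d)).withDensity fun x => ENNReal.ofReal (gaussianTilt u x)) :=
    isFiniteMeasure_withDensity_ofReal (integrable_gaussianTilt u).2
  apply Measure.ext_of_charFun
  ext t
  have h1 : charFun ((stdGaussian (Rd d)).map fun x => u + x) t
      = Complex.exp (⟪u, t⟫ * Complex.I - (‖t‖ ^ 2 : ℝ) / 2) := by
    rw [charFun_map_const_add, charFun_stdGaussian, ← Complex.exp_add]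
    push_cast
    ring_nf
  rw [h1, charFun_apply, integral_withDensity_eq_integral_toReal_smul (by fun_prop) (by simp)]
  have h2 (x : Rd d) : (ENNReal.ofReal (gaussianTilt u x)).toReal
      • Complex.exp (⟪x, t⟫ * Complex.I) = Complex.exp (-((‖u‖ ^ 2 : ℝ) / 2))
        * Complex.exp (⟪u, x⟫ + ⟪x, t⟫ * Complex.I) := by
    rw [ENNReal.toReal_ofReal (gaussianTilt_pos u x).le, Complex.real_smul, gaussianTilt,
      Complex.ofReal_exp, ← Complex.exp_add, ← Complex.exp_add]
    push_cast
    ring_nf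
  simp_rw [h2]
  rw [integral_const_mul, integral_cexp_stdGaussian, ← Complex.exp_add]
  push_cast
  ring_nf

end Gaussian

/-! ### Divergences between finite Gaussian mixtures -/

section Mixture

open ProbabilityTheory

variable {d : ℕ} {ι : Type*} [Fintype ι]

/-- The density with respect to `N(0, I)` of the signed Gaussian mixture with weights `a` and
centers `x`. -/
noncomputable def tiltSum (a : ι → ℝ) (x : ι → Rd d) (y : Rd d) : ℝ :=
  ∑ i, a i * gaussianTilt (x i) y

@[fun_prop]
lemma measurable_tiltSum (a : ι → ℝ) (x : ι → Rd d) : Measurable (tiltSum a x) := by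
  unfold tiltSum
  fun_prop

lemma tiltSum_nonneg {a : ι → ℝ} (ha : ∀ i, 0 ≤ a i) (x : ι → Rd d) (y : Rd d) :
    0 ≤ tiltSum a x y :=
  Finset.sum_nonneg fun i _ => mul_nonneg (ha i) (gaussianTilt_pos _ _).le

lemma gaussianMixture_sum_dirac (w : ι → ℝ) (hw : ∀ j, 0 ≤ w j) (μ : ι → Rd d) :
    gaussianMixture (∑ j, ENNReal.ofReal (w j) • Measure.dirac (μ j))
      = (stdGaussian (Rd d)).withDensity fun y => ENNReal.ofReal (tiltSum w μ y) := by
  classical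
  unfold gaussianMixture tiltSum
  induction (Finset.univ : Finset ι) using Finset.induction_on with
  | empty => simp
  | insert j s hj ih =>
    have hfin : IsFiniteMeasure (∑ j ∈ s, ENNReal.ofReal (w j) • Measure.dirac (μ j)) := by
      refine ⟨?_⟩
      simp [Measure.finsetSum_apply, ENNReal.sum_lt_top]
    have hfin' : IsFiniteMeasure (ENNReal.ofReal (w j) • Measure.dirac (μ j)) := by
      refine ⟨?_⟩
      simp
    simp_rw [Finset.sum_insert hj]
    rw [Measure.add_conv, ih, Measure.conv_smul_left, Measure.dirac_conv,
      map_const_add_stdGaussian, ← withDensity_smul _ (by fun_prop),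
      ← withDensity_add_left (by fun_prop)]
    congr 1
    ext y
    rw [Pi.add_apply, Pi.smul_apply, smul_eq_mul, ← ENNReal.ofReal_mul (hw j),
      ENNReal.ofReal_add (mul_nonneg (hw j) (gaussianTilt_pos _ _).le)
        (Finset.sum_nonneg fun i _ => mul_nonneg (hw i) (gaussianTilt_pos _ _).le)]

/-- Completing the square: the weight `c` only shifts both centers in the exponential kernel, up to
the factor `exp (-‖c‖ ^ 2)`. -/
lemma gaussianTilt_mul_mul (u v c y : Rd d) :
    gaussianTilt c y * (gaussianTilt u y * gaussianTilt v y)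
      = Real.exp (-‖c‖ ^ 2) * Real.exp ⟪u + c, v + c⟫ * gaussianTilt (u + v + c) y := by
  rw [gaussianTilt_mul_gaussianTilt, mul_comm, mul_assoc, gaussianTilt_mul_gaussianTilt, ← mul_assoc,
    ← Real.exp_add, ← Real.exp_add]
  congr 2
  simp only [inner_add_left, inner_add_right, real_inner_self_eq_norm_sq, real_inner_comm v c]
  ring

lemma gaussianTilt_mul_tiltSum_sq (a : ι → ℝ) (x : ι → Rd d) (c y : Rd d) :
    gaussianTilt c y * tiltSum a x y ^ 2 = ∑ i, ∑ j, Real.exp (-‖c‖ ^ 2)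
      * (a i * a j * Real.exp ⟪x i + c, x j + c⟫) * gaussianTilt (x i + x j + c) y := by
  rw [tiltSum, pow_two, Finset.sum_mul_sum, Finset.mul_sum]
  refine Finset.sum_congr rfl fun i _ => ?_
  rw [Finset.mul_sum]
  refine Finset.sum_congr rfl fun j _ => ?_
  linear_combination a i * a j * gaussianTilt_mul_mul (x i) (x j) c y

lemma integrable_gaussianTilt_mul_tiltSum_sq (a : ι → ℝ) (x : ι → Rd d) (c : Rd d) :
    Integrable (fun y => gaussianTilt c y * tiltSum a x y ^ 2) (stdGaussian (Rd d)) := by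
  simp_rw [gaussianTilt_mul_tiltSum_sq]
  exact integrable_finsetSum _ fun i _ => integrable_finsetSum _ fun j _ =>
    (integrable_gaussianTilt _).const_mul _

lemma integral_gaussianTilt_mul_tiltSum_sq (a : ι → ℝ) (x : ι → Rd d) (c : Rd d) :
    ∫ y, gaussianTilt c y * tiltSum a x y ^ 2 ∂(stdGaussian (Rd d))
      = Real.exp (-‖c‖ ^ 2) * ∑ i, ∑ j, a i * a j * Real.exp ⟪x i + c, x j + c⟫ := by
  simp_rw [gaussianTilt_mul_tiltSum_sq]
  rw [integral_finsetSum _ fun i _ => integrable_finsetSum _ fun j _ =>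
    (integrable_gaussianTilt _).const_mul _, Finset.mul_sum]
  refine Finset.sum_congr rfl fun i _ => ?_
  rw [integral_finsetSum _ fun j _ => (integrable_gaussianTilt _).const_mul _, Finset.mul_sum]
  refine Finset.sum_congr rfl fun j _ => ?_
  rw [integral_const_mul, integral_gaussianTilt, mul_one]

lemma integral_gaussianTilt_mul_tiltSum_sq_le (a : ι → ℝ) {x : ι → Rd d} {n : ℕ} {r δ : ℝ}
    (hr : 1 ≤ r) (hδ : ∀ l < n, tensorNorm a (List.replicate l x) ≤ δ) {c : Rd d} (hc : ‖c‖ ≤ r)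
    (hn : Fintype.card ι ≤ n) (hx : ∀ i, ‖x i‖ ≤ r) (hδ0 : 0 ≤ δ) :
    ∫ y, gaussianTilt c y * tiltSum a x y ^ 2 ∂(stdGaussian (Rd d))
      ≤ Real.exp (16 * r ^ 2) * δ ^ 2 := by
  rw [integral_gaussianTilt_mul_tiltSum_sq]
  refine (mul_le_mul_of_nonneg_left (sum_exp_inner_add_le a hr hδ hc hn hx hδ0)
    (Real.exp_pos _).le).trans (mul_le_of_le_one_left (by positivity) ?_)
  rw [Real.exp_le_one_iff]
  simp

/-- A mixture density is bounded below by a Gaussian density centered at the mean. -/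
lemma exists_inv_tiltSum_le {w : ι → ℝ} {μ : ι → Rd d} {r : ℝ} (hw : ∀ j, 0 ≤ w j)
    (hw1 : ∑ j, w j = 1) (hμ : ∀ j, ‖μ j‖ ≤ r) :
    ∃ c : Rd d, ‖c‖ ≤ r ∧ ∀ y, 0 < tiltSum w μ y ∧
      (tiltSum w μ y)⁻¹ ≤ Real.exp (r ^ 2) * gaussianTilt c y := by
  have hm : ‖∑ j, w j • μ j‖ ≤ r := by
    refine (norm_sum_le _ _).trans ?_
    calc ∑ j, ‖w j • μ j‖ ≤ ∑ j, w j * r := by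
          refine Finset.sum_le_sum fun j _ => ?_
          rw [norm_smul, Real.norm_of_nonneg (hw j)]
          exact mul_le_mul_of_nonneg_left (hμ j) (hw j)
      _ = r := by rw [← Finset.sum_mul, hw1, one_mul]
  have hr : 0 ≤ r := (norm_nonneg _).trans hm
  -- The sign flips because the tilt bounds the reciprocal of the density.
  refine ⟨-∑ j, w j • μ j, by rwa [norm_neg], fun y => ?_⟩
  -- Jensen's inequality for `exp` under the weights `w`.
  have hj : Real.exp (⟪∑ j, w j • μ j, y⟫ - r ^ 2 / 2) ≤ tiltSum w μ y := by
    have h1 := convexOn_exp.map_sum_le (t := Finset.univ) (w := w)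
      (p := fun j => ⟪μ j, y⟫ - ‖μ j‖ ^ 2 / 2) (fun j _ => hw j) hw1 (fun _ _ => Set.mem_univ _)
    simp only [smul_eq_mul] at h1
    refine le_trans (Real.exp_le_exp.2 ?_) h1
    calc ⟪∑ j, w j • μ j, y⟫ - r ^ 2 / 2
        = ∑ j, w j * (⟪μ j, y⟫ - r ^ 2 / 2) := by
          simp_rw [mul_sub]
          rw [Finset.sum_sub_distrib, ← Finset.sum_mul, hw1, one_mul, sum_inner]
          simp [real_inner_smul_left]
      _ ≤ _ := by
          refine Finset.sum_le_sum fun j _ => mul_le_mul_of_nonneg_left ?_ (hw j)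
          have := pow_le_pow_left₀ (norm_nonneg _) (hμ j) 2
          linarith
  refine ⟨(Real.exp_pos _).trans_le hj, ?_⟩
  refine (inv_anti₀ (Real.exp_pos _) hj).trans ?_
  rw [← Real.exp_neg, gaussianTilt, ← Real.exp_add, Real.exp_le_exp, inner_neg_left, norm_neg]
  have := pow_le_pow_left₀ (norm_nonneg _) hm 2
  linarith

lemma chiSqDiv_withDensity {α : Type*} [MeasurableSpace α] (γ : Measure α) [SigmaFinite γ]
    {p q : α → ℝ} (hp : Measurable p) (hq : Measurable q) (hq0 : ∀ x, 0 < q x) :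
    chiSqDiv (γ.withDensity fun x => ENNReal.ofReal (p x))
        (γ.withDensity fun x => ENNReal.ofReal (q x))
      = ∫⁻ x, ENNReal.ofReal (q x * ((ENNReal.ofReal (p x / q x)).toReal - 1) ^ 2) ∂γ := by
  have hPQ : (γ.withDensity fun x => ENNReal.ofReal (p x))
      = (γ.withDensity fun x => ENNReal.ofReal (q x)).withDensity
        fun x => ENNReal.ofReal (p x / q x) := by
    rw [← withDensity_mul _ (by fun_prop) (by fun_prop)]
    congr 1
    ext x
    rw [Pi.mul_apply, ← ENNReal.ofReal_mul (hq0 x).le, mul_div_cancel₀ _ (hq0 x).ne']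
  have : SigmaFinite (γ.withDensity fun x => ENNReal.ofReal (q x)) :=
    SigmaFinite.withDensity_of_ne_top' (by simp)
  rw [hPQ, chiSqDiv, if_pos (withDensity_absolutelyContinuous _ _)]
  have hrn := Measure.rnDeriv_withDensity (γ.withDensity fun x => ENNReal.ofReal (q x))
    (f := fun x => ENNReal.ofReal (p x / q x)) (by fun_prop)
  rw [lintegral_congr_ae (g := fun x =>
    ENNReal.ofReal (((ENNReal.ofReal (p x / q x)).toReal - 1) ^ 2))
    (hrn.mono fun x hx => by simp only [hx]),
    lintegral_withDensity_eq_lintegral_mul _ (by fun_prop) (by fun_prop)]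
  refine lintegral_congr fun x => ?_
  rw [Pi.mul_apply, ← ENNReal.ofReal_mul (hq0 x).le]

lemma tiltSum_sum_elim {κ : Type*} [Fintype κ] (w : ι → ℝ) (w' : κ → ℝ) (μ : ι → Rd d)
    (μ' : κ → Rd d) (y : Rd d) :
    tiltSum (Sum.elim w (-w')) (Sum.elim μ μ') y = tiltSum w μ y - tiltSum w' μ' y := by
  simp [tiltSum, sub_eq_add_neg]

lemma momentTensor_sum_dirac (w : ι → ℝ) (hw : ∀ j, 0 ≤ w j) (μ : ι → Rd d) (l : ℕ)
    (e : Fin l → Fin d) :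
    momentTensor l (∑ j, ENNReal.ofReal (w j) • Measure.dirac (μ j)) e
      = ∑ j, w j * ∏ i, μ j (e i) := by
  rw [momentTensor, integral_finsetSum_measure fun j _ =>
    Integrable.smul_measure (integrable_dirac (by simp)) (by simp)]
  refine Finset.sum_congr rfl fun j _ => ?_
  rw [integral_smul_measure, integral_dirac, ENNReal.toReal_ofReal (hw j), smul_eq_mul]

lemma tensorSq_replicate (a : ι → ℝ) (x : ι → Rd d) (l : ℕ) :
    tensorSq a (List.replicate l x) = ∑ e : Fin l → Fin d, (∑ i, a i * ∏ s, x i (e s)) ^ 2 := by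
  rw [← sum_sum_mul_gram a (fun i (e : Fin l → Fin d) => ∏ s, x i (e s)), tensorSq]
  refine Finset.sum_congr rfl fun i _ => Finset.sum_congr rfl fun j _ => ?_
  rw [List.map_replicate, List.prod_replicate, rd_inner_eq_sum, Finset.sum_pow',
    Fintype.piFinset_univ]
  simp_rw [Finset.prod_mul_distrib]

lemma frobeniusNorm_momentTensor_sub_sq {κ : Type*} [Fintype κ] (w : ι → ℝ) (hw : ∀ j, 0 ≤ w j)
    (w' : κ → ℝ) (hw' : ∀ j, 0 ≤ w' j) (μ : ι → Rd d) (μ' : κ → Rd d) (l : ℕ) :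
    frobeniusNorm (momentTensor l (∑ j, ENNReal.ofReal (w j) • Measure.dirac (μ j))
        - momentTensor l (∑ j, ENNReal.ofReal (w' j) • Measure.dirac (μ' j))) ^ 2
      = tensorSq (Sum.elim w (-w')) (List.replicate l (Sum.elim μ μ')) := by
  rw [frobeniusNorm, Real.sq_sqrt (by positivity), tensorSq_replicate]
  refine Finset.sum_congr rfl fun e _ => ?_
  rw [Pi.sub_apply, momentTensor_sum_dirac w hw, momentTensor_sum_dirac w' hw']
  simp [sub_eq_add_neg]

lemma chiSqDiv_mixture_le {κ : Type*} [Fintype κ] {w : ι → ℝ} {w' : κ → ℝ} {μ : ι → Rd d}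
    {μ' : κ → Rd d} {n : ℕ} {r δ : ℝ} (hw : ∀ j, 0 ≤ w j) (hw' : ∀ j, 0 ≤ w' j)
    (hw1' : ∑ j, w' j = 1) (hr : 1 ≤ r) (hμ : ∀ j, ‖μ j‖ ≤ r) (hμ' : ∀ j, ‖μ' j‖ ≤ r)
    (hδ : ∀ l < n, tensorNorm (Sum.elim w (-w')) (List.replicate l (Sum.elim μ μ')) ≤ δ)
    (hn : Fintype.card (ι ⊕ κ) ≤ n) (hδ0 : 0 ≤ δ) :
    chiSqDiv ((stdGaussian (Rd d)).withDensity fun y => ENNReal.ofReal (tiltSum w μ y))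
        ((stdGaussian (Rd d)).withDensity fun y => ENNReal.ofReal (tiltSum w' μ' y))
      ≤ ENNReal.ofReal (Real.exp (r ^ 2) * (Real.exp (16 * r ^ 2) * δ ^ 2)) := by
  obtain ⟨c, hc, hq⟩ := exists_inv_tiltSum_le hw' hw1' hμ'
  rw [chiSqDiv_withDensity _ (by fun_prop) (by fun_prop) fun y => (hq y).1]
  have hb := integral_gaussianTilt_mul_tiltSum_sq_le _ hr hδ hc hn
    (by rintro (i | i); exacts [hμ i, hμ' i]) hδ0
  refine le_trans ?_ (ENNReal.ofReal_le_ofReal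
    (mul_le_mul_of_nonneg_left hb (Real.exp_pos (r ^ 2)).le))
  rw [← integral_const_mul, ofReal_integral_eq_lintegral_ofReal
    ((integrable_gaussianTilt_mul_tiltSum_sq _ _ c).const_mul _) (ae_of_all _ fun y =>
      mul_nonneg (Real.exp_pos _).le (mul_nonneg (gaussianTilt_pos _ _).le (sq_nonneg _)))]
  refine lintegral_mono fun y => ENNReal.ofReal_le_ofReal ?_
  obtain ⟨hq0, hqi⟩ := hq y
  rw [ENNReal.toReal_ofReal (div_nonneg (tiltSum_nonneg hw _ _) hq0.le), tiltSum_sum_elim]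
  calc tiltSum w' μ' y * (tiltSum w μ y / tiltSum w' μ' y - 1) ^ 2
      = (tiltSum w' μ' y)⁻¹ * (tiltSum w μ y - tiltSum w' μ' y) ^ 2 := by
        field_simp
    _ ≤ _ := by
        rw [← mul_assoc]
        exact mul_le_mul_of_nonneg_right hqi (sq_nonneg _)

lemma integrable_mixture_iff {w : ι → ℝ} {μ : ι → Rd d} (hw : ∀ j, 0 ≤ w j) (g : Rd d → ℝ) :
    Integrable g ((stdGaussian (Rd d)).withDensity fun y => ENNReal.ofReal (tiltSum w μ y))
      ↔ Integrable (fun y => tiltSum w μ y * g y) (stdGaussian (Rd d)) := by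
  rw [integrable_withDensity_iff_integrable_smul' (by fun_prop) (by simp)]
  simp_rw [ENNReal.toReal_ofReal (tiltSum_nonneg hw μ _), smul_eq_mul]

lemma integral_mixture {w : ι → ℝ} {μ : ι → Rd d} (hw : ∀ j, 0 ≤ w j) (g : Rd d → ℝ) :
    ∫ y, g y ∂((stdGaussian (Rd d)).withDensity fun y => ENNReal.ofReal (tiltSum w μ y))
      = ∫ y, tiltSum w μ y * g y ∂(stdGaussian (Rd d)) := by
  rw [integral_withDensity_eq_integral_toReal_smul (by fun_prop) (by simp)]
  simp_rw [ENNReal.toReal_ofReal (tiltSum_nonneg hw μ _), smul_eq_mul]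

lemma integrable_tiltSum_mul_tiltSum {κ : Type*} [Fintype κ] (w : ι → ℝ) (μ : ι → Rd d)
    (a : κ → ℝ) (x : κ → Rd d) :
    Integrable (fun y => tiltSum w μ y * tiltSum a x y) (stdGaussian (Rd d)) := by
  have h (y : Rd d) : tiltSum w μ y * tiltSum a x y = ∑ i, ∑ j,
      w i * a j * Real.exp ⟪μ i, x j⟫ * gaussianTilt (μ i + x j) y := by
    rw [tiltSum, tiltSum, Finset.sum_mul_sum]
    refine Finset.sum_congr rfl fun i _ => Finset.sum_congr rfl fun j _ => ?_
    linear_combination w i * a j * gaussianTilt_mul_gaussianTilt (μ i) (x j) y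
  simp_rw [h]
  exact integrable_finsetSum _ fun i _ => integrable_finsetSum _ fun j _ =>
    (integrable_gaussianTilt _).const_mul _

lemma integrable_tiltSum_mul_tiltSum_sq {κ : Type*} [Fintype κ] (w : ι → ℝ) (μ : ι → Rd d)
    (a : κ → ℝ) (x : κ → Rd d) :
    Integrable (fun y => tiltSum w μ y * tiltSum a x y ^ 2) (stdGaussian (Rd d)) := by
  have h (y : Rd d) : tiltSum w μ y * tiltSum a x y ^ 2 = ∑ i,
      w i * (gaussianTilt (μ i) y * tiltSum a x y ^ 2) := by
    rw [tiltSum, Finset.sum_mul]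
    exact Finset.sum_congr rfl fun i _ => by ring
  simp_rw [h]
  exact integrable_finsetSum _ fun i _ => (integrable_gaussianTilt_mul_tiltSum_sq _ _ _).const_mul _

lemma integral_tiltSum_mul_tiltSum_sq_le {κ : Type*} [Fintype κ] {w : ι → ℝ} {μ : ι → Rd d}
    (a : κ → ℝ) {x : κ → Rd d} {n : ℕ} {r δ : ℝ} (hw : ∀ j, 0 ≤ w j) (hw1 : ∑ j, w j = 1)
    (hμ : ∀ j, ‖μ j‖ ≤ r) (hr : 1 ≤ r)
    (hδ : ∀ l < n, tensorNorm a (List.replicate l x) ≤ δ)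
    (hn : Fintype.card κ ≤ n) (hx : ∀ i, ‖x i‖ ≤ r) (hδ0 : 0 ≤ δ) :
    ∫ y, tiltSum w μ y * tiltSum a x y ^ 2 ∂(stdGaussian (Rd d))
      ≤ Real.exp (16 * r ^ 2) * δ ^ 2 := by
  have h (y : Rd d) : tiltSum w μ y * tiltSum a x y ^ 2 = ∑ i,
      w i * (gaussianTilt (μ i) y * tiltSum a x y ^ 2) := by
    rw [tiltSum, Finset.sum_mul]
    exact Finset.sum_congr rfl fun i _ => by ring
  simp_rw [h]
  rw [integral_finsetSum _ fun i _ =>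
    (integrable_gaussianTilt_mul_tiltSum_sq _ _ _).const_mul _]
  simp_rw [integral_const_mul]
  calc _ ≤ ∑ i, w i * (Real.exp (16 * r ^ 2) * δ ^ 2) := Finset.sum_le_sum fun i _ =>
        mul_le_mul_of_nonneg_left
          (integral_gaussianTilt_mul_tiltSum_sq_le a hr hδ (hμ i) hn hx hδ0) (hw i)
    _ = _ := by rw [← Finset.sum_mul, hw1, one_mul]

lemma isFiniteMeasure_mixture (w : ι → ℝ) (μ : ι → Rd d) :
    IsFiniteMeasure ((stdGaussian (Rd d)).withDensity fun y => ENNReal.ofReal (tiltSum w μ y)) :=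
  isFiniteMeasure_withDensity_ofReal
    (integrable_finsetSum _ fun _ _ => (integrable_gaussianTilt _).const_mul _ :
      Integrable (tiltSum w μ) _).2

/-- The variational bound is tested on the difference of the densities, whose mean difference is its
own squared `L²` norm under `N(0, I)`. -/
lemma tensorSq_le_hellingerSq_mixture {κ : Type*} [Fintype κ] {w : ι → ℝ} {w' : κ → ℝ}
    {μ : ι → Rd d} {μ' : κ → Rd d} {n : ℕ} {r δ : ℝ} (hw : ∀ j, 0 ≤ w j) (hw1 : ∑ j, w j = 1)
    (hw' : ∀ j, 0 ≤ w' j) (hw1' : ∑ j, w' j = 1) (hr : 1 ≤ r) (hμ : ∀ j, ‖μ j‖ ≤ r)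
    (hμ' : ∀ j, ‖μ' j‖ ≤ r)
    (hδ : ∀ l < n, tensorNorm (Sum.elim w (-w')) (List.replicate l (Sum.elim μ μ')) ≤ δ)
    (hn : Fintype.card (ι ⊕ κ) ≤ n) (hδ0 : 0 ≤ δ) {l : ℕ}
    (hl : tensorSq (Sum.elim w (-w')) (List.replicate l (Sum.elim μ μ')) = δ ^ 2) :
    ENNReal.ofReal ((4 * Real.exp (16 * r ^ 2) * (l.factorial : ℝ) ^ 2)⁻¹ * δ ^ 2) ≤
      hellingerSq ((stdGaussian (Rd d)).withDensity fun y => ENNReal.ofReal (tiltSum w μ y))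
        ((stdGaussian (Rd d)).withDensity fun y => ENNReal.ofReal (tiltSum w' μ' y)) := by
  have := isFiniteMeasure_mixture w μ
  have := isFiniteMeasure_mixture w' μ'
  obtain ⟨H, hH, hvar⟩ := exists_hellingerSq_eq_ofReal
    ((stdGaussian (Rd d)).withDensity fun y => ENNReal.ofReal (tiltSum w μ y))
    ((stdGaussian (Rd d)).withDensity fun y => ENNReal.ofReal (tiltSum w' μ' y))
  rw [hH]
  refine ENNReal.ofReal_le_ofReal ?_
  set a := Sum.elim w (-w') with ha
  set x := Sum.elim μ μ' with hx
  have hxr : ∀ i, ‖x i‖ ≤ r := by rintro (i | i); exacts [hμ i, hμ' i]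
  set K := Real.exp (16 * r ^ 2) with hK
  have hK0 : 0 < K := Real.exp_pos _
  have hN : (0 : ℝ) < l.factorial := by exact_mod_cast l.factorial_pos
  set N := (l.factorial : ℝ)
  -- The choice `t = 4 * K * N` makes the second-moment term exactly half of the main term `δ ^ 2 /
  -- N`.
  have h := hvar (tiltSum a x) (4 * K * N) (by positivity)
    ((integrable_mixture_iff hw _).2 (integrable_tiltSum_mul_tiltSum _ _ _ _))
    ((integrable_mixture_iff hw' _).2 (integrable_tiltSum_mul_tiltSum _ _ _ _))
    ((integrable_mixture_iff hw _).2 (integrable_tiltSum_mul_tiltSum_sq _ _ _ _))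
    ((integrable_mixture_iff hw' _).2 (integrable_tiltSum_mul_tiltSum_sq _ _ _ _))
  simp only [integral_mixture hw, integral_mixture hw'] at h
  rw [← integral_sub (integrable_tiltSum_mul_tiltSum _ _ _ _)
    (integrable_tiltSum_mul_tiltSum _ _ _ _)] at h
  have hG : ∫ y, (tiltSum w μ y * tiltSum a x y - tiltSum w' μ' y * tiltSum a x y)
      ∂(stdGaussian (Rd d)) = ∑ i, ∑ j, a i * a j * Real.exp ⟪x i, x j⟫ := by
    have h0 := integral_gaussianTilt_mul_tiltSum_sq a x 0
    simp only [norm_zero, add_zero, ne_eq, OfNat.ofNat_ne_zero, not_false_eq_true, zero_pow,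
      neg_zero, Real.exp_zero, one_mul] at h0
    rw [← h0]
    congr 1
    ext y
    rw [← sub_mul, ← tiltSum_sum_elim, pow_two, gaussianTilt]
    simp [ha, hx]
  rw [hG] at h
  have h1 := tensorSq_replicate_div_factorial_le a x l
  rw [hl] at h1
  have h2 := integral_tiltSum_mul_tiltSum_sq_le a hw hw1 hμ hr hδ hn hxr hδ0
  have h3 := integral_tiltSum_mul_tiltSum_sq_le a hw' hw1' hμ' hr hδ hn hxr hδ0
  have h4 : δ ^ 2 / N ≤ 4 * K * N / 2 * H + (4 * K * N)⁻¹ * (K * δ ^ 2 + K * δ ^ 2) :=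
    h1.trans (h.trans (by gcongr))
  have h5 : (4 * K * N)⁻¹ * (K * δ ^ 2 + K * δ ^ 2) = δ ^ 2 / N / 2 := by
    field_simp
    ring
  rw [h5] at h4
  have h6 : δ ^ 2 / N ≤ 4 * K * N * H := by linarith
  rw [inv_mul_le_iff₀ (by positivity)]
  rw [div_le_iff₀ hN] at h6
  linarith

end Mixture

/-! ### Constants and conclusion -/

lemma four_mul_factorial_sq_le {k l : ℕ} (hk : 1 ≤ k) (hl : l ≤ 2 * k - 1) {K C : ℝ}
    (hK : 1 ≤ K) (hC : 8 * K ≤ C) :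
    4 * K * (l.factorial : ℝ) ^ 2 ≤ (C * k) ^ (4 * k) := by
  have h1 : (l.factorial : ℝ) ≤ (2 * k) ^ (2 * k) := by
    have h := (Nat.factorial_le (show l ≤ 2 * k by omega)).trans (Nat.factorial_le_pow (2 * k))
    exact_mod_cast h
  have h2 : (l.factorial : ℝ) ^ 2 ≤ (2 * k) ^ (4 * k) := by
    calc (l.factorial : ℝ) ^ 2 ≤ ((2 * (k : ℝ)) ^ (2 * k)) ^ 2 := by gcongr
      _ = (2 * (k : ℝ)) ^ (4 * k) := by rw [← pow_mul]; ring_nf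
  have h3 : 4 * K ≤ (4 * K) ^ (4 * k) := le_self_pow₀ (by linarith) (by omega)
  calc 4 * K * (l.factorial : ℝ) ^ 2 ≤ (4 * K) ^ (4 * k) * (2 * k) ^ (4 * k) := by gcongr
    _ = (8 * K * k) ^ (4 * k) := by rw [← mul_pow]; ring_nf
    _ ≤ (C * k) ^ (4 * k) := by gcongr

theorem mainTheorem3 (R : ℝ) (hR : 0 ≤ R) :
    ∃ C : ℝ, 0 < C ∧
      ∀ k d : ℕ, 1 ≤ k →
        ∀ Γ ∈ kAtomic k d R, ∀ Γ' ∈ kAtomic k d R,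
          ∀ D ∈ ({hellingerSq, InformationTheory.klDiv, chiSqDiv} :
              Set (Measure (Rd d) → Measure (Rd d) → ℝ≥0∞)),
            ENNReal.ofReal (((C * k) ^ (4 * k))⁻¹ * maxMomentDiffSq k Γ Γ')
                ≤ D (gaussianMixture Γ) (gaussianMixture Γ') ∧
              D (gaussianMixture Γ) (gaussianMixture Γ')
                ≤ ENNReal.ofReal (C * Real.exp (36 * (k : ℝ) ^ 2) * maxMomentDiffSq k Γ Γ') := by
  -- Interpolation needs a radius of at least `1`.
  set r := max 1 R
  have hr : 1 ≤ r := le_max_left _ _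
  -- The exponent `17 = 16 + 1` adds the kernel bound and the Jensen loss. The factor `8` serves the
  -- lower bound; `exp (36 * k ^ 2)` is pure slack.
  refine ⟨8 * Real.exp (17 * r ^ 2), by positivity, ?_⟩
  rintro k d hk Γ ⟨w, μ, hw, hw1, hμ, rfl⟩ Γ' ⟨w', μ', hw', hw1', hμ', rfl⟩ D hD
  replace hμ j : ‖μ j‖ ≤ r := (hμ j).trans (le_max_right _ _)
  replace hμ' j : ‖μ' j‖ ≤ r := (hμ' j).trans (le_max_right _ _)
  set Γ := ∑ j, ENNReal.ofReal (w j) • Measure.dirac (μ j) with hΓ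
  set Γ' := ∑ j, ENNReal.ofReal (w' j) • Measure.dirac (μ' j) with hΓ'
  set a := Sum.elim w (-w') with ha
  set x := Sum.elim μ μ' with hx
  obtain ⟨l, hl, hmax⟩ := Finset.exists_mem_eq_sup' (Finset.nonempty_Iic (a := 2 * k - 1))
    fun l => frobeniusNorm (momentTensor l Γ - momentTensor l Γ') ^ 2
  change maxMomentDiffSq k Γ Γ' = _ at hmax
  rw [hΓ, hΓ', frobeniusNorm_momentTensor_sub_sq w hw w' hw', ← hΓ, ← hΓ', ← ha, ← hx] at hmax
  have hle : ∀ m < 2 * k, tensorSq a (List.replicate m x) ≤ maxMomentDiffSq k Γ Γ' := by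
    intro m hm
    rw [ha, hx, ← frobeniusNorm_momentTensor_sub_sq w hw w' hw']
    exact Finset.le_sup' (fun l => frobeniusNorm (momentTensor l Γ - momentTensor l Γ') ^ 2)
      (Finset.mem_Iic.2 (by omega))
  have hM0 : 0 ≤ maxMomentDiffSq k Γ Γ' := hmax ▸ tensorSq_nonneg _ _
  set M := maxMomentDiffSq k Γ Γ'
  have hδ : ∀ m < 2 * k, tensorNorm a (List.replicate m x) ≤ Real.sqrt M := fun m hm =>
    Real.sqrt_le_sqrt (hle m hm)
  -- The two mixtures have `2 * k` atoms together, exactly the number of available orders `0, …, 2 *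
  -- k - 1`.
  have hcard : Fintype.card (Fin k ⊕ Fin k) ≤ 2 * k := by simp [two_mul]
  have hP := gaussianMixture_sum_dirac w hw μ
  have hQ := gaussianMixture_sum_dirac w' hw' μ'
  rw [← hΓ] at hP
  rw [← hΓ'] at hQ
  have hup := chiSqDiv_mixture_le hw hw' hw1' hr hμ hμ' hδ hcard (Real.sqrt_nonneg _)
  have hlow := tensorSq_le_hellingerSq_mixture hw hw1 hw' hw1' hr hμ hμ' hδ hcard
    (Real.sqrt_nonneg _) (l := l) (by rw [Real.sq_sqrt hM0, hmax])
  rw [← hP, ← hQ, Real.sq_sqrt hM0] at hup hlow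
  have hfP : IsFiniteMeasure (gaussianMixture Γ) := hP ▸ isFiniteMeasure_mixture w μ
  have hfQ : IsFiniteMeasure (gaussianMixture Γ') := hQ ▸ isFiniteMeasure_mixture w' μ'
  have hHK := hellingerSq_le_klDiv (gaussianMixture Γ) (gaussianMixture Γ')
  have hKX := klDiv_le_chiSqDiv (gaussianMixture Γ) (gaussianMixture Γ')
  have hexp : Real.exp (r ^ 2) * Real.exp (16 * r ^ 2) = Real.exp (17 * r ^ 2) := by
    rw [← Real.exp_add]
    ring_nf
  have hlow' : ENNReal.ofReal (((8 * Real.exp (17 * r ^ 2) * k) ^ (4 * k))⁻¹ * M)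
      ≤ hellingerSq (gaussianMixture Γ) (gaussianMixture Γ') := by
    refine le_trans (ENNReal.ofReal_le_ofReal (mul_le_mul_of_nonneg_right
      (inv_anti₀ (by positivity) ?_) hM0)) hlow
    refine four_mul_factorial_sq_le hk (Finset.mem_Iic.1 hl) (Real.one_le_exp (by positivity)) ?_
    gcongr
    norm_num
  have hup' : chiSqDiv (gaussianMixture Γ) (gaussianMixture Γ')
      ≤ ENNReal.ofReal (8 * Real.exp (17 * r ^ 2) * Real.exp (36 * (k : ℝ) ^ 2) * M) := by
    refine hup.trans (ENNReal.ofReal_le_ofReal ?_)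
    rw [← mul_assoc, hexp]
    refine mul_le_mul_of_nonneg_right ?_ hM0
    have h1 : 1 ≤ Real.exp (36 * (k : ℝ) ^ 2) := Real.one_le_exp (by positivity)
    have h2 := Real.exp_pos (17 * r ^ 2)
    nlinarith
  simp only [Set.mem_insert_iff, Set.mem_singleton_iff] at hD
  rcases hD with rfl | rfl | rfl
  · exact ⟨hlow', hHK.trans (hKX.trans hup')⟩
  · exact ⟨hlow'.trans hHK, hKX.trans hup'⟩
  · exact ⟨hlow'.trans (hHK.trans hKX), hup'⟩
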